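/- Let $K$ be an algebraically closed subfield of $\mathbb{C}$ of finite transcendence degree over $\mathbb{Q}$ with $\pi\in K$. Call a tuple $b_1,\dots,b_n$ of complex numbers linearly independent over $\sqrt{-1}\,\pi$ if $\sqrt{-1}\,\pi,b_1,\dots,b_n$ are $\mathbb{Q}$-linearly independent. Let $a_1,\dots,a_s\in K$ be linearly independent over $\sqrt{-1}\,\pi$, and let $$\Gamma^*=\{g\in\mathbb{C}^\times : g^n\in[\exp(a_1),\dots,\exp(a_s)]\text{ for some } n\geq 1\},$$ where $[A]$ denotes the subgroup of $\mathbb{C}^\times$ generated by $A$. Let $\mathbb{U}\subseteq\mathbb{C}^\times$ be the group of all roots of unity, and let $L\subseteq\mathbb{C}$ be a finitely generated field extension of $\mathbb{Q}(\mathbb{U})$ containing $\exp(a_1),\dots,\exp(a_s)$. Then there are $t'\in\mathbb{N}$ and $c_1,\dots,c_{t'}\in K$, linearly independent over $\sqrt{-1}\,\pi$, such that for every $k$ and all $\lambda_1,\dots,\lambda_k\in L$ the following holds: if $x_1,\dots,x_k\in\Gamma^*$ satisfy $\lambda_1x_1+\cdots+\lambda_kx_k=1$ and $\sum_{i\in I}\lambda_ix_i\neq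 0$ for every nonempty proper subset $I\subset\{1,\dots,k\}$, then each $x_i$ lies in $\mathbb{U}\cdot[\exp(c_1),\dots,\exp(c_{t'})]$. -/

import Mathlib

/-- The exponential of a complex number, as an element of `ℂˣ`. -/
noncomputable def expUnit (z : ℂ) : ℂˣ :=
  Units.mk0 (Complex.exp z) (Complex.exp_ne_zero z)

/-- The group `𝕌` of all complex roots of unity. -/
def rootsOfUnityGroup : Subgroup ℂˣ := CommGroup.torsion ℂˣ

/-- The field `ℚ(𝕌)`, as a subfield of `ℂ`. -/
noncomputable def cyclotomicClosure : IntermediateField ℚ ℂ :=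
  IntermediateField.adjoin ℚ ((fun u : ℂˣ => (u : ℂ)) '' (rootsOfUnityGroup : Set ℂˣ))

/-- The smallest radical subgroup `⟨A⟩` of an abelian group `G` containing `A`: all `g` with
`g ^ n` in the subgroup generated by `A` for some `n > 0`. -/
def radicalHull {G : Type*} [CommGroup G] (A : Set G) : Subgroup G where
  carrier := {g | ∃ n : ℕ, 0 < n ∧ g ^ n ∈ Subgroup.closure A}
  one_mem' := ⟨1, one_pos, by simp⟩
  mul_mem' := by
    rintro a b ⟨m, hm, ha⟩ ⟨n, hn, hb⟩
    refine ⟨m * n, Nat.mul_pos hm hn, ?_⟩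
    rw [mul_pow, pow_mul, mul_comm m n, pow_mul]
    exact mul_mem (pow_mem ha n) (pow_mem hb m)
  inv_mem' := by
    rintro a ⟨m, hm, ha⟩
    refine ⟨m, hm, ?_⟩
    rw [inv_pow]
    exact inv_mem ha

/-- The tuple `a` is linearly independent over `√-1 π`, i.e. `√-1 π, a₁, …, aₙ` are
`ℚ`-linearly independent. -/
def LinearIndependentOverIPi {n : ℕ} (a : Fin n → ℂ) : Prop :=
  LinearIndependent ℚ (Fin.cons (Complex.I * (Real.pi : ℂ)) a : Fin (n + 1) → ℂ)

/-- `x` is a non-degenerate solution of `l₁ x₁ + ⋯ + lₖ xₖ = 1`. -/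
def IsNondegenerateSolution {k : ℕ} (l : Fin k → ℂ) (x : Fin k → ℂˣ) : Prop :=
  ∑ i, l i * (x i : ℂ) = 1 ∧
    ∀ J : Finset (Fin k), J.Nonempty → J ≠ Finset.univ → ∑ i ∈ J, l i * (x i : ℂ) ≠ 0

/-!
Over the subfield `L` of `ℂ`, which contains the roots of unity, an automorphism `g` multiplies a
radical `x i` by a root of unity `χ i g`. The maps `χ i` are characters of the Galois group, and
`∑ l i * x i * χ i g = 1` for all `g`. By independence of characters, the partial sum over all `i`
with a given `χ i ≠ 1` vanishes, so non-degeneracy makes every `χ i` trivial, that is, `x i ∈ L`.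

It remains to see that the part of `radicalHull A` lying in `L` is finitely generated modulo roots
of unity. Write `L` inside `F(𝕌)` with `F` finitely generated over `ℚ`. As `F(𝕌)/F` is abelian,
every radical over `F` in `F(𝕌)` has its `w`-th power in `𝕌 · Fˣ`, where `w` bounds the order of
the roots of unity in `F`. This reduces the claim to the finite generation of the radical hull of a
finite set in `Fˣ`, for which only the elements `∏ α i ^ q i` with rational `q i ∈ [0, 1]` matter.
Under every specialisation `ℤ[T] → ℤ` of the transcendentals these have bounded conjugates, hence
they have finitely many minimal polynomials. Finally, logarithms modulo `√-1 π` turn a finitely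
generated group of exponentials into a lattice with basis `c`.
-/

section GrowthOfPolynomials

open MvPolynomial

variable {σ R : Type*} [CommSemiring R]

/-- The restriction of a polynomial to the line `m ↦ m • v` through the origin. Its coefficients are
the values at `v` of the homogeneous components, which relates total degree to growth. -/
noncomputable def restrictLine (v : σ → R) (P : MvPolynomial σ R) : Polynomial R :=
  aeval (fun i => Polynomial.C (v i) * Polynomial.X) P

lemma eval_restrictLine (v : σ → R) (P : MvPolynomial σ R) (m : R) :
    (restrictLine v P).eval m = eval (fun i => v i * m) P := by
  induction P using MvPolynomial.induction_on <;> simp_all [restrictLine]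

lemma restrictLine_monomial (v : σ → R) (u : σ →₀ ℕ) (a : R) :
    restrictLine v (monomial u a) = Polynomial.monomial u.degree (eval v (monomial u a)) := by
  simp [restrictLine, aeval_monomial, eval_monomial, mul_pow, Finsupp.prod,
    Finset.prod_mul_distrib, Finset.prod_pow_eq_pow_sum, Finsupp.degree_apply,
    ← Polynomial.C_mul_X_pow_eq_monomial, mul_assoc]

lemma coeff_restrictLine (v : σ → R) (P : MvPolynomial σ R) (k : ℕ) :
    (restrictLine v P).coeff k = eval v (homogeneousComponent k P) := by
  classical
  have h : restrictLine v P =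
      ∑ u ∈ P.support, Polynomial.monomial u.degree (eval v (monomial u (P.coeff u))) := by
    conv_lhs => rw [P.as_sum, restrictLine, map_sum]
    exact Finset.sum_congr rfl fun u _ => restrictLine_monomial v u _
  rw [h, homogeneousComponent_apply, map_sum, Finset.sum_filter, Polynomial.finsetSum_coeff]
  simp only [Polynomial.coeff_monomial]

lemma natDegree_restrictLine_le (v : σ → R) (P : MvPolynomial σ R) :
    (restrictLine v P).natDegree ≤ P.totalDegree := by
  refine Polynomial.natDegree_le_iff_coeff_eq_zero.2 fun k hk => ?_
  rw [coeff_restrictLine, homogeneousComponent_eq_zero k P hk, map_zero]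

lemma totalDegree_le_of_abs_eval_le {P Q : MvPolynomial σ ℤ}
    (h : ∀ τ, |eval τ P| ≤ eval τ Q) : P.totalDegree ≤ Q.totalDegree := by
  have vanishing (k : ℕ) (hk : Q.totalDegree < k) : homogeneousComponent k P = 0 := by
    refine MvPolynomial.funext fun v => ?_
    rw [← coeff_restrictLine, map_zero]
    refine Polynomial.coeff_eq_zero_of_natDegree_lt (lt_of_not_ge fun hle => ?_)
    have hfin := Polynomial.finite_abs_eval_le_of_degree_lt (Polynomial.degree_lt_degree
      ((natDegree_restrictLine_le v Q).trans_lt (hk.trans_le hle)))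
    refine Set.infinite_univ (hfin.subset fun m _ => ?_)
    simp only [Set.mem_ofPred_eq, eval_restrictLine]
    exact (h _).trans (le_abs_self _)
  rw [← P.sum_homogeneousComponent]
  refine totalDegree_finsetSum_le fun k _ => ?_
  by_cases hk : Q.totalDegree < k
  · simp [vanishing k hk]
  · exact (homogeneousComponent_isHomogeneous k P).totalDegree_le.trans (not_lt.1 hk)

theorem finite_setOf_abs_eval_le [Finite σ] (Q : MvPolynomial σ ℤ) :
    {P : MvPolynomial σ ℤ | ∀ τ, |eval τ P| ≤ eval τ Q}.Finite := by
  classical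
  have := Fintype.ofFinite σ
  let interval : Finset ℤ := Finset.Icc 0 Q.totalDegree
  let grid : Finset (σ → ℤ) := Fintype.piFinset fun _ => interval
  have hvalues : (Set.univ.pi fun τ : grid => Set.Icc (-eval τ.1 Q) (eval τ.1 Q)).Finite :=
    Set.Finite.pi fun τ => Set.finite_Icc _ _
  refine .of_finite_image (f := fun P (τ : grid) => eval τ.1 P) (hvalues.subset ?_) ?_
  · rintro _ ⟨P, hP, rfl⟩ τ -
    exact abs_le.1 (hP τ)
  · intro P hP P' hP' hPP'
    refine sub_eq_zero.1 (eq_zero_of_eval_zero_at_prod_finset (P - P') (fun _ => interval)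
      (fun i => ?_) fun τ hτ => ?_)
    · calc (P - P').degreeOf i ≤ max P.totalDegree P'.totalDegree :=
          (degreeOf_le_totalDegree _ i).trans (totalDegree_sub P P')
        _ ≤ Q.totalDegree :=
          max_le (totalDegree_le_of_abs_eval_le hP) (totalDegree_le_of_abs_eval_le hP')
        _ < interval.card := by simp [interval]
    · simpa [sub_eq_zero] using congrFun hPP' ⟨τ, Fintype.mem_piFinset.2 hτ⟩

end GrowthOfPolynomials

section RootBound

variable {A : Type*} [CommRing A]

/-- A bound for the complex roots of every specialisation of a monic polynomial `p` over `A` along a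
homomorphism `A →+* ℤ`. Squares replace absolute values, which is harmless since `|c| ≤ c ^ 2` for
integers `c`, so that the bound is itself an element of `A` and can be specialised. -/
noncomputable def rootBound (p : Polynomial A) : A :=
  1 + ∑ i ∈ Finset.range p.natDegree, p.coeff i ^ 2

lemma one_le_map_rootBound (p : Polynomial A) (φ : A →+* ℤ) : 1 ≤ φ (rootBound p) := by
  simp only [rootBound, map_add, map_one, map_sum, map_pow]
  exact le_add_of_nonneg_right (Finset.sum_nonneg fun _ _ => sq_nonneg _)

lemma norm_le_map_rootBound {p : Polynomial A} (hp : p.Monic) (φ : A →+* ℤ) {z : ℂ}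
    (hz : p.eval₂ ((Int.castRingHom ℂ).comp φ) z = 0) : ‖z‖ ≤ φ (rootBound p) := by
  set q := p.map ((Int.castRingHom ℂ).comp φ) with hq
  have hroot : q.IsRoot z := by rwa [Polynomial.IsRoot, hq, Polynomial.eval_map]
  have hsup : ((Finset.range q.natDegree).sup fun i => ‖q.coeff i‖₊) ≤
      ∑ i ∈ Finset.range q.natDegree, ‖q.coeff i‖₊ :=
    Finset.sup_le fun i hi => Finset.single_le_sum_of_canonicallyOrdered
      (f := fun i => ‖q.coeff i‖₊) hi
  have hsq (i : ℕ) : ‖q.coeff i‖ ≤ (φ (p.coeff i) : ℝ) ^ 2 := by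
    rw [hq, Polynomial.coeff_map, RingHom.comp_apply, eq_intCast, Complex.norm_intCast]
    exact_mod_cast (Int.abs_eq_natAbs _).trans_le (Int.natAbs_le_self_sq _)
  calc ‖z‖ ≤ q.cauchyBound := (hroot.norm_lt_cauchyBound (hp.map _).ne_zero).le
    _ ≤ 1 + ∑ i ∈ Finset.range q.natDegree, ‖q.coeff i‖ := by
        rw [Polynomial.cauchyBound, (hp.map _).leadingCoeff, add_comm]
        simpa only [nnnorm_one, div_one, NNReal.coe_add, NNReal.coe_one, NNReal.coe_sum,
          coe_nnnorm, add_le_add_iff_left] using NNReal.coe_le_coe.2 hsup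
    _ ≤ φ (rootBound p) := by
        push_cast [rootBound, map_add, map_sum, map_pow, map_one]
        rw [hq, hp.natDegree_map, ← hq]
        gcongr
        exact hsq _

end RootBound

section ExtensionOfHomomorphisms

variable {A B Ω : Type*} [CommRing A] [CommRing B] [Algebra A B] [Algebra.IsIntegral A B]
  [Field Ω] [IsAlgClosed Ω]

theorem exists_ringHom_comp_algebraMap_eq [FaithfulSMul A B] (φ : A →+* Ω) :
    ∃ Φ : B →+* Ω, Φ.comp (algebraMap A B) = φ := by
  have : (RingHom.ker φ).IsPrime := RingHom.ker_isPrime φ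
  obtain ⟨Q, _, _⟩ := (Ideal.nonempty_primesOver (S := B) (RingHom.ker φ)).some
  let : Algebra (A ⧸ RingHom.ker φ) Ω := (RingHom.kerLift φ).toAlgebra
  have : FaithfulSMul (A ⧸ RingHom.ker φ) Ω :=
    (faithfulSMul_iff_algebraMap_injective _ _).2 (RingHom.kerLift_injective φ)
  have : IsDomain (A ⧸ RingHom.ker φ) := Ideal.Quotient.isDomain _
  have : IsDomain (B ⧸ Q) := Ideal.Quotient.isDomain _
  have : Module.IsTorsionFree (A ⧸ RingHom.ker φ) (B ⧸ Q) :=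
    Module.isTorsionFree_iff_faithfulSMul.2 inferInstance
  have : Module.IsTorsionFree (A ⧸ RingHom.ker φ) Ω :=
    Module.isTorsionFree_iff_faithfulSMul.2 inferInstance
  let Ψ : B ⧸ Q →ₐ[A ⧸ RingHom.ker φ] Ω := IsAlgClosed.lift
  exact ⟨Ψ.toRingHom.comp (Ideal.Quotient.mk Q),
    RingHom.ext fun x => Ψ.commutes (Ideal.Quotient.mk _ x)⟩

theorem exists_ringHom_apply_eq_of_eval₂_minpoly_eq_zero [IsDomain A] [IsIntegrallyClosed A]
    [IsDomain B] [Module.IsTorsionFree A B] (φ : A →+* Ω) (y : B) {z : Ω}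
    (hz : (minpoly A y).eval₂ φ z = 0) :
    ∃ Φ : B →+* Ω, Φ.comp (algebraMap A B) = φ ∧ Φ y = z := by
  have hy : IsIntegral A y := Algebra.IsIntegral.isIntegral y
  let y' : Algebra.adjoin A {y} := ⟨y, Algebra.self_mem_adjoin_singleton A y⟩
  let φ' : Algebra.adjoin A {y} →+* Ω :=
    (AdjoinRoot.lift φ z hz).comp (minpoly.equivAdjoin hy).symm.toRingEquiv.toRingHom
  have hφ' (x : A) : φ' (algebraMap A _ x) = φ x := by simp [φ']
  have hφ'y : φ' y' = z := by
    have : (minpoly.equivAdjoin hy).symm y' = AdjoinRoot.root _ := by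
      rw [AlgEquiv.symm_apply_eq]
      simp [y', AdjoinRoot.Minpoly.toAdjoin]
    simp [φ', this]
  have : Algebra.IsIntegral (Algebra.adjoin A {y}) B := Algebra.IsIntegral.tower_top A
  obtain ⟨Φ, hΦ⟩ := exists_ringHom_comp_algebraMap_eq (B := B) φ'
  exact ⟨Φ, RingHom.ext fun x => (RingHom.congr_fun hΦ (algebraMap A _ x)).trans (hφ' x),
    (RingHom.congr_fun hΦ y').trans hφ'y⟩

end ExtensionOfHomomorphisms

/-- The elements `∏ α i ^ q i` with rational exponents `q i ∈ [0, 1]`, where roots may be chosen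
arbitrarily. -/
def rationalBox {M ι : Type*} [CommMonoid M] [Fintype ι] (α : ι → M) : Set M :=
  {y | ∃ n : ℕ, 0 < n ∧ ∃ e : ι → ℕ, (∀ i, e i ≤ n) ∧ y ^ n = ∏ i, α i ^ e i}

lemma map_mem_rationalBox {M N ι : Type*} [CommMonoid M] [CommMonoid N] [Fintype ι] (f : M →* N)
    {α : ι → M} {y : M} (hy : y ∈ rationalBox α) : f y ∈ rationalBox fun i => f (α i) := by
  obtain ⟨n, hn, e, he, hye⟩ := hy
  exact ⟨n, hn, e, he, by simp only [← map_pow, hye, map_prod]⟩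

section Northcott

variable {A B ι : Type*} [CommRing A] [CommRing B] [IsDomain B] [Algebra A B]
  [Algebra.IsIntegral A B] [Module.IsTorsionFree A B] [Fintype ι]

lemma norm_le_of_mem_rationalBox [IsDomain A] [IsIntegrallyClosed A] (φ : A →+* ℤ) {α : ι → B}
    {y : B} (hy : y ∈ rationalBox α) {z : ℂ}
    (hz : (minpoly A y).eval₂ ((Int.castRingHom ℂ).comp φ) z = 0) :
    ‖z‖ ≤ φ (∏ i, rootBound (minpoly A (α i))) := by
  obtain ⟨Φ, hΦ, rfl⟩ := exists_ringHom_apply_eq_of_eval₂_minpoly_eq_zero _ y hz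
  obtain ⟨n, hn, e, he, hye⟩ := hy
  have hmonic (i : ι) : (minpoly A (α i)).Monic := minpoly.monic (Algebra.IsIntegral.isIntegral _)
  have hbound (i : ι) : ‖Φ (α i)‖ ≤ φ (rootBound (minpoly A (α i))) := by
    refine norm_le_map_rootBound (hmonic i) φ ?_
    rw [← hΦ, ← Polynomial.hom_eval₂, ← Polynomial.aeval_def, minpoly.aeval, map_zero]
  have hone (i : ι) : (1 : ℝ) ≤ φ (rootBound (minpoly A (α i))) := by
    exact_mod_cast one_le_map_rootBound _ φ
  push_cast [map_prod]
  refine le_of_pow_le_pow_left₀ hn.ne' (Finset.prod_nonneg fun i _ => zero_le_one.trans (hone i)) ?_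
  calc ‖Φ y‖ ^ n = ∏ i, ‖Φ (α i)‖ ^ e i := by
        rw [← norm_pow, ← map_pow, hye, map_prod, norm_prod]
        simp only [map_pow, norm_pow]
    _ ≤ ∏ i, (φ (rootBound (minpoly A (α i))) : ℝ) ^ n := by
        refine Finset.prod_le_prod (fun _ _ => by positivity) fun i _ => ?_
        exact (pow_le_pow_left₀ (norm_nonneg _) (hbound i) _).trans
          (pow_le_pow_right₀ (hone i) (he i))
    _ = _ := Finset.prod_pow _ _ _

lemma abs_map_coeff_minpoly_le [IsDomain A] [IsIntegrallyClosed A] (φ : A →+* ℤ) {α : ι → B}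
    {y : B} (hy : y ∈ rationalBox α) {d : ℕ} (hd : (minpoly A y).natDegree ≤ d) (j : ℕ) :
    |φ ((minpoly A y).coeff j)| ≤
      φ ((∏ i, rootBound (minpoly A (α i))) ^ d * d.choose (d / 2)) := by
  set b := ∏ i, rootBound (minpoly A (α i)) with hb
  have hone : 1 ≤ φ b := by
    rw [hb, map_prod]
    exact Finset.one_le_prod fun i _ => one_le_map_rootBound _ φ
  have hcoeff := Polynomial.coeff_bdd_of_roots_le ((Int.castRingHom ℂ).comp φ)
    (minpoly.monic (Algebra.IsIntegral.isIntegral (R := A) y)) (IsAlgClosed.splits _) hd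
    (fun z hz => norm_le_of_mem_rationalBox φ hy <| by
      rw [← Polynomial.eval_map]
      exact (Polynomial.mem_roots'.1 hz).2) j
  rw [max_eq_left (by exact_mod_cast hone), Polynomial.coeff_map, RingHom.comp_apply,
    eq_intCast, Complex.norm_intCast] at hcoeff
  rw [map_mul, map_pow, map_natCast]
  exact_mod_cast hcoeff

theorem finite_setOf_mem_rationalBox_natDegree_minpoly_le {σ : Type*} [Finite σ]
    [Algebra (MvPolynomial σ ℤ) B] [Algebra.IsIntegral (MvPolynomial σ ℤ) B]
    [Module.IsTorsionFree (MvPolynomial σ ℤ) B] (α : ι → B) (d : ℕ) :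
    {y ∈ rationalBox α | (minpoly (MvPolynomial σ ℤ) y).natDegree ≤ d}.Finite := by
  classical
  let coeffBound : MvPolynomial σ ℤ :=
    (∏ i, rootBound (minpoly (MvPolynomial σ ℤ) (α i))) ^ d * d.choose (d / 2)
  refine (Polynomial.bUnion_roots_finite (algebraMap (MvPolynomial σ ℤ) B) d
    (finite_setOf_abs_eval_le coeffBound)).subset fun y ⟨hy, hd⟩ => ?_
  have hmonic : (minpoly (MvPolynomial σ ℤ) y).Monic :=
    minpoly.monic (Algebra.IsIntegral.isIntegral y)
  refine Set.mem_biUnion (x := minpoly (MvPolynomial σ ℤ) y)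
    ⟨hd, fun j τ => abs_map_coeff_minpoly_le (MvPolynomial.eval τ) hy hd j⟩ ?_
  rw [Finset.mem_coe, Multiset.mem_toFinset, Polynomial.mem_roots (hmonic.map _).ne_zero,
    Polynomial.IsRoot, Polynomial.eval_map_algebraMap, minpoly.aeval]

end Northcott

section RadicalHull

variable {G H ι : Type*} [CommGroup G] [CommGroup H]

lemma subset_radicalHull (A : Set G) : A ⊆ radicalHull A :=
  fun x hx => ⟨1, one_pos, by simpa using Subgroup.subset_closure hx⟩

lemma torsion_le_radicalHull (A : Set G) : CommGroup.torsion G ≤ radicalHull A := by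
  intro x hx
  obtain ⟨n, hn, hxn⟩ := isOfFinOrder_iff_pow_eq_one.1 hx
  exact ⟨n, hn, hxn ▸ one_mem _⟩

lemma radicalHull_mono_of_subset_closure {A A' : Set G} (h : A ⊆ Subgroup.closure A') :
    radicalHull A ≤ radicalHull A' :=
  fun _ ⟨n, hn, hx⟩ => ⟨n, hn, (Subgroup.closure_le _).2 h hx⟩

lemma map_mem_radicalHull_image_iff {f : G →* H} (hf : Function.Injective f) {A : Set G} {x : G} :
    f x ∈ radicalHull (f '' A) ↔ x ∈ radicalHull A := by
  refine exists_congr fun n => and_congr_right fun _ => ?_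
  rw [← map_pow, ← MonoidHom.map_closure, Subgroup.mem_map_iff_mem hf]

lemma rationalBox_subset_radicalHull [Fintype ι] (γ : ι → G) :
    rationalBox γ ⊆ radicalHull (Set.range γ) := by
  rintro u ⟨n, hn, e, -, hu⟩
  exact ⟨n, hn, hu ▸ prod_mem fun i _ =>
    pow_mem (Subgroup.subset_closure (Set.mem_range_self i)) _⟩

lemma exists_div_mem_rationalBox [Fintype ι] {γ : ι → G} {x : G}
    (hx : x ∈ radicalHull (Set.range γ)) :
    ∃ v ∈ Subgroup.closure (Set.range γ), x / v ∈ rationalBox γ := by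
  obtain ⟨n, hn, hxn⟩ := hx
  obtain ⟨k, hk⟩ := Subgroup.exists_of_mem_closure_range γ _ hxn
  have hn' : (0 : ℤ) < n := by exact_mod_cast hn
  refine ⟨∏ i, γ i ^ (k i / n), prod_mem fun i _ =>
    zpow_mem (Subgroup.subset_closure (Set.mem_range_self i)) _,
    n, hn, fun i => (k i % n).toNat, fun i => ?_, ?_⟩
  · exact Int.toNat_le.2 (Int.emod_lt_of_pos (k i) hn').le
  · rw [div_pow, hk, ← Finset.prod_pow, ← Finset.prod_div_distrib]
    refine Finset.prod_congr rfl fun i _ => ?_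
    rw [← zpow_natCast (γ i) (k i % n).toNat, Int.toNat_of_nonneg (Int.emod_nonneg _ hn'.ne'),
      Int.emod_def, mul_comm, zpow_sub, zpow_mul, zpow_natCast, div_eq_mul_inv]

lemma fg_radicalHull_of_finite_rationalBox [Fintype ι] {γ : ι → G} (h : (rationalBox γ).Finite) :
    (radicalHull (Set.range γ)).FG := by
  refine (Subgroup.fg_iff _).2
    ⟨rationalBox γ ∪ Set.range γ, le_antisymm ?_ fun x hx => ?_, h.union (Set.finite_range γ)⟩
  · rw [Subgroup.closure_le]
    exact Set.union_subset (rationalBox_subset_radicalHull γ) (subset_radicalHull _)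
  · obtain ⟨v, hv, hxv⟩ := exists_div_mem_rationalBox hx
    rw [← div_mul_cancel x v]
    exact mul_mem (Subgroup.subset_closure (.inl hxv))
      (Subgroup.closure_mono Set.subset_union_right hv)

lemma fg_map_of_fg {P : Subgroup G} (hP : P.FG) (f : G →* H) : (P.map f).FG :=
  (Subgroup.fg_iff_submonoid_fg _).2 (((Subgroup.fg_iff_submonoid_fg P).1 hP).map f)

lemma fg_of_le_of_fg {P Q : Subgroup G} (hPQ : P ≤ Q) (hQ : Q.FG) : P.FG := by
  have : Group.FG Q := (Group.fg_iff_subgroup_fg Q).2 hQ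
  have : Module.Finite ℤ (Additive Q) := Module.Finite.iff_addGroup_fg.2 inferInstance
  have : (P.subgroupOf Q).FG := (Subgroup.fg_iff_add_fg _).2 <|
    (Submodule.fg_iff_addSubgroup_fg (P.subgroupOf Q).toAddSubgroup.toIntSubmodule).1
      (IsNoetherian.noetherian _)
  have : Group.FG (P.subgroupOf Q) := (Group.fg_iff_subgroup_fg _).2 this
  exact (Group.fg_iff_subgroup_fg P).1
    (Group.fg_of_surjective (f := (Subgroup.subgroupOfEquivOfLe hPQ).toMonoidHom)
      (Subgroup.subgroupOfEquivOfLe hPQ).surjective)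

end RadicalHull

section FieldsFinitelyGeneratedOverQ

lemma finite_rationalBox_of_isIntegral {σ K F ι : Type*} [Finite σ] [Field K] [Field F]
    [Algebra (MvPolynomial σ ℤ) K] [IsFractionRing (MvPolynomial σ ℤ) K]
    [Algebra (MvPolynomial σ ℤ) F] [Algebra K F] [IsScalarTower (MvPolynomial σ ℤ) K F]
    [FiniteDimensional K F] [Fintype ι] {α : ι → F}
    (hα : ∀ i, IsIntegral (MvPolynomial σ ℤ) (α i)) : (rationalBox α).Finite := by
  let B := integralClosure (MvPolynomial σ ℤ) F
  have hinj : Function.Injective (algebraMap (MvPolynomial σ ℤ) F) := by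
    rw [IsScalarTower.algebraMap_eq (MvPolynomial σ ℤ) K F]
    exact (algebraMap K F).injective.comp (IsFractionRing.injective _ K)
  have : Module.IsTorsionFree (MvPolynomial σ ℤ) F :=
    Module.isTorsionFree_iff_faithfulSMul.2 ((faithfulSMul_iff_algebraMap_injective _ _).2 hinj)
  refine ((finite_setOf_mem_rationalBox_natDegree_minpoly_le (B := B) (σ := σ)
    (fun i => ⟨α i, hα i⟩) (Module.finrank K F)).image Subtype.val).subset
    fun y ⟨n, hn, e, he, hy⟩ => ?_
  have hyint : IsIntegral (MvPolynomial σ ℤ) y := by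
    refine IsIntegral.of_pow hn ?_
    rw [hy]
    exact IsIntegral.prod _ fun i _ => (hα i).pow _
  refine ⟨⟨y, hyint⟩, ⟨⟨n, hn, e, he, Subtype.ext (by simpa using hy)⟩, ?_⟩, rfl⟩
  rw [← minpoly.algebraMap_eq (B' := F) Subtype.val_injective]
  change (minpoly _ y).natDegree ≤ _
  rw [← (minpoly.monic hyint).natDegree_map (algebraMap _ K),
    ← minpoly.isIntegrallyClosed_eq_field_fractions K F hyint]
  exact minpoly.natDegree_le y

lemma fg_radicalHull_of_isIntegral {σ K F ι : Type*} [Finite σ] [Field K] [Field F]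
    [Algebra (MvPolynomial σ ℤ) K] [IsFractionRing (MvPolynomial σ ℤ) K]
    [Algebra (MvPolynomial σ ℤ) F] [Algebra K F] [IsScalarTower (MvPolynomial σ ℤ) K F]
    [FiniteDimensional K F] [Finite ι] {γ : ι → Fˣ}
    (hγ : ∀ i, IsIntegral (MvPolynomial σ ℤ) (γ i : F)) : (radicalHull (Set.range γ)).FG := by
  have := Fintype.ofFinite ι
  refine fg_radicalHull_of_finite_rationalBox
    (((finite_rationalBox_of_isIntegral (K := K) hγ).preimage Units.val_injective.injOn).subset ?_)
  exact fun y hy => map_mem_rationalBox (Units.coeHom F) hy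

lemma fg_radicalHull_of_finiteDimensional {σ K F ι : Type*} [Finite σ] [Field K] [Field F]
    [Algebra (MvPolynomial σ ℤ) K] [IsFractionRing (MvPolynomial σ ℤ) K]
    [Algebra (MvPolynomial σ ℤ) F] [Algebra K F] [IsScalarTower (MvPolynomial σ ℤ) K F]
    [FiniteDimensional K F] [Finite ι] (γ : ι → Fˣ) : (radicalHull (Set.range γ)).FG := by
  classical
  have := Fintype.ofFinite ι
  have : Algebra.IsAlgebraic (MvPolynomial σ ℤ) F :=
    (IsFractionRing.comap_isAlgebraic_iff (K := K)).2 inferInstance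
  obtain ⟨b, hb0, hb⟩ := Algebra.IsAlgebraic.exists_integral_multiples (MvPolynomial σ ℤ)
    (Finset.univ.image fun i => (γ i : F))
  have hβ0 : algebraMap (MvPolynomial σ ℤ) F b ≠ 0 := by
    rw [IsScalarTower.algebraMap_apply (MvPolynomial σ ℤ) K F]
    simpa using hb0
  let β : Fˣ := Units.mk0 _ hβ0
  let γ' : Option ι → Fˣ := fun i => i.elim β fun i => β * γ i
  have hγ' (i : Option ι) : IsIntegral (MvPolynomial σ ℤ) (γ' i : F) := by
    cases i with
    | none => exact isIntegral_algebraMap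
    | some i =>
      have := hb (γ i) (by simp)
      rwa [Algebra.smul_def] at this
  refine fg_of_le_of_fg (radicalHull_mono_of_subset_closure ?_)
    (fg_radicalHull_of_isIntegral (K := K) hγ')
  rintro _ ⟨i, rfl⟩
  rw [← inv_mul_cancel_left β (γ i)]
  have hmem (j : Option ι) : γ' j ∈ Subgroup.closure (Set.range γ') :=
    Subgroup.subset_closure (Set.mem_range_self j)
  exact mul_mem (inv_mem (hmem none)) (hmem (some i))

theorem fg_radicalHull {F ι : Type*} [Field F] [Algebra ℚ F] [Algebra.EssFiniteType ℚ F] [Finite ι]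
    (γ : ι → Fˣ) : (radicalHull (Set.range γ)).FG := by
  obtain ⟨s, hs⟩ := exists_finset_isTranscendenceBasis ℚ F
  have : CharZero F := algebraRat.charZero F
  have : Algebra.IsAlgebraic ℤ ℚ :=
    (IsFractionRing.comap_isAlgebraic_iff (K := ℚ)).2 inferInstance
  have hsℤ : IsTranscendenceBasis ℤ ((↑) : s → F) :=
    (Algebra.IsAlgebraic.isTranscendenceBasis_iff ℤ ℚ).2 hs
  let : Algebra (MvPolynomial s ℤ) F := (MvPolynomial.aeval ((↑) : s → F)).toAlgebra
  have : FaithfulSMul (MvPolynomial s ℤ) F :=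
    (faithfulSMul_iff_algebraMap_injective _ _).2 hsℤ.1
  have : Algebra.IsAlgebraic (MvPolynomial s ℤ) F := by
    have := hsℤ.isAlgebraic
    exact Algebra.IsAlgebraic.of_ringHom_of_comp_eq hsℤ.1.aevalEquiv (RingHom.id F)
      hsℤ.1.aevalEquiv.surjective Function.injective_id (RingHom.ext fun p => rfl)
  let : Algebra (FractionRing (MvPolynomial s ℤ)) F := FractionRing.liftAlgebra _ _
  have : IsScalarTower (MvPolynomial s ℤ) (FractionRing (MvPolynomial s ℤ)) F :=
    FractionRing.isScalarTower_liftAlgebra _ _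
  have : Algebra.IsAlgebraic (FractionRing (MvPolynomial s ℤ)) F :=
    (IsFractionRing.comap_isAlgebraic_iff (A := MvPolynomial s ℤ)).1 inferInstance
  have : Algebra.EssFiniteType (FractionRing (MvPolynomial s ℤ)) F :=
    Algebra.EssFiniteType.of_comp ℚ _ _
  have : FiniteDimensional (FractionRing (MvPolynomial s ℤ)) F :=
    Algebra.finite_of_essFiniteType_of_isAlgebraic
  exact fg_radicalHull_of_finiteDimensional (σ := s) (K := FractionRing (MvPolynomial s ℤ)) γ

lemma exists_pow_eq_one_of_mem_torsion (F : Type*) [Field F] [Algebra ℚ F]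
    [Algebra.EssFiniteType ℚ F] :
    ∃ w : ℕ, 0 < w ∧ ∀ u ∈ CommGroup.torsion Fˣ, u ^ w = 1 := by
  have hfg : (CommGroup.torsion Fˣ).FG :=
    fg_of_le_of_fg (torsion_le_radicalHull _) (fg_radicalHull (F := F) (ι := Empty) nofun)
  have : Group.FG (CommGroup.torsion Fˣ) := (Group.fg_iff_subgroup_fg _).2 hfg
  have : Finite (CommGroup.torsion Fˣ) :=
    CommGroup.finite_of_fg_isMulTorsion _ fun u => Submonoid.isOfFinOrder_coe.1 u.2
  exact ⟨_, Nat.card_pos (α := CommGroup.torsion Fˣ), fun u hu =>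
    congrArg Subtype.val (pow_card_eq_one' (x := (⟨u, hu⟩ : CommGroup.torsion Fˣ)))⟩

end FieldsFinitelyGeneratedOverQ

lemma exists_fg_forall_mem_of_pow_mem {M : Type*} [CommGroup M] {w : ℕ} (hw : 0 < w)
    {G : Subgroup M} (hG : G.FG) :
    ∃ G' : Subgroup M, G'.FG ∧
      ∀ x, x ^ w ∈ CommGroup.torsion M ⊔ G → x ∈ CommGroup.torsion M ⊔ G' := by
  have htors {x : M} (hx : x ^ w ∈ CommGroup.torsion M) : x ∈ CommGroup.torsion M :=
    (isOfFinOrder_pow.1 hx).resolve_right hw.ne'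
  obtain ⟨S, hS⟩ := fg_of_le_of_fg (inf_le_left (b := CommGroup.torsion M ⊔
    (powMonoidHom w : M →* M).range)) hG
  have hroot (s : S) : ∃ t ∈ CommGroup.torsion M, ∃ r : M, t * r ^ w = s := by
    have hs : (s : M) ∈ G ⊓ (CommGroup.torsion M ⊔ (powMonoidHom w : M →* M).range) :=
      hS ▸ Subgroup.subset_closure s.2
    obtain ⟨t, ht, _, ⟨r, rfl⟩, hr⟩ := Subgroup.mem_sup.1 hs.2
    exact ⟨t, ht, r, hr⟩
  choose t ht r hr using hroot
  refine ⟨Subgroup.closure (Set.range r), (Subgroup.fg_iff _).2 ⟨_, rfl, Set.finite_range r⟩,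
    fun x hx => ?_⟩
  obtain ⟨u, hu, g, hg, hug⟩ := Subgroup.mem_sup.1 hx
  have hgS : g ∈ Subgroup.closure (S : Set M) := by
    rw [hS]
    refine ⟨hg, Subgroup.mem_sup.2 ⟨u⁻¹, inv_mem hu, x ^ w, ⟨x, rfl⟩, ?_⟩⟩
    rw [← hug, inv_mul_cancel_left]
  have hle : Subgroup.closure (S : Set M) ≤
      CommGroup.torsion M ⊔ (Subgroup.closure (Set.range r)).map (powMonoidHom w) := by
    rw [Subgroup.closure_le]
    intro s hs
    have hs' : t ⟨s, hs⟩ * r ⟨s, hs⟩ ^ w = s := hr _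
    rw [SetLike.mem_coe, ← hs']
    exact Subgroup.mul_mem_sup (ht _)
      ⟨r ⟨s, hs⟩, Subgroup.subset_closure (Set.mem_range_self _), rfl⟩
  obtain ⟨u', hu', _, ⟨y, hy, rfl⟩, huy⟩ := Subgroup.mem_sup.1 (hle hgS)
  refine Subgroup.mem_sup.2 ⟨x / y, htors ?_, y, hy, div_mul_cancel x y⟩
  rw [div_pow, ← hug, ← huy, powMonoidHom_apply, ← mul_assoc, mul_div_cancel_right]
  exact mul_mem hu hu'

lemma mem_range_unitsMap_iff {F E : Type*} [Field F] [Field E] {f : F →+* E} {u : Eˣ} :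
    u ∈ (Units.map (f : F →* E)).range ↔ (u : E) ∈ f.range := by
  constructor
  · rintro ⟨v, rfl⟩
    exact ⟨v, rfl⟩
  · rintro ⟨v, hv⟩
    have hv0 : v ≠ 0 := fun h0 => u.ne_zero (by rw [← hv, h0, map_zero])
    exact ⟨Units.mk0 v hv0, Units.ext hv⟩

section Kummer

variable {F E : Type*} [Field F] [Field E] [Algebra F E]

lemma mem_range_unitsMap_algebraMap_iff_smul_eq [IsGalois F E] {u : Eˣ} :
    u ∈ (Units.map (algebraMap F E : F →* E)).range ↔ ∀ g : Gal(E/F), g • u = u := by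
  rw [mem_range_unitsMap_iff]
  exact (InfiniteGalois.mem_range_algebraMap_iff_fixed _).trans
    ⟨fun h g => Units.ext (h g), fun h g => congrArg Units.val (h g)⟩

lemma smul_div_self_mem_rootsOfUnity [IsGalois F E] {x : Eˣ} {n : ℕ}
    (hx : x ^ n ∈ (Units.map (algebraMap F E : F →* E)).range) (g : Gal(E/F)) :
    g • x / x ∈ rootsOfUnity n E := by
  rw [mem_rootsOfUnity, div_pow, ← smul_pow', mem_range_unitsMap_algebraMap_iff_smul_eq.1 hx g,
    div_self']

lemma zpow_sub_one_mem_of_smul_eq_zpow [IsGalois F E] [IsMulCommutative Gal(E/F)] {x : Eˣ} {n : ℕ}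
    (hx : x ^ n ∈ (Units.map (algebraMap F E : F →* E)).range) {g : Gal(E/F)} {m : ℤ}
    (hg : ∀ ζ ∈ rootsOfUnity n E, g • ζ = ζ ^ m) :
    x ^ (m - 1) ∈ (Units.map (algebraMap F E : F →* E)).range ⊔ rootsOfUnity n E := by
  -- `h` multiplies `x` by some `ζ` and, commuting with `g`, multiplies `g • x` by `g • ζ = ζ ^ m`.
  have hfixed : x ^ m / g • x ∈ (Units.map (algebraMap F E : F →* E)).range := by
    rw [mem_range_unitsMap_algebraMap_iff_smul_eq]
    intro h
    obtain ⟨ζ, hζ⟩ : ∃ ζ, ζ = h • x / x := ⟨_, rfl⟩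
    have hhx : h • x = ζ * x := by rw [hζ, div_mul_cancel]
    rw [smul_div', smul_zpow', smul_smul, IsMulCommutative.is_comm.comm h g, mul_smul, hhx,
      smul_mul', hg ζ (hζ ▸ smul_div_self_mem_rootsOfUnity hx h), mul_zpow,
      mul_div_mul_left_eq_div]
  have hsplit : x ^ (m - 1) = x ^ m / g • x * (g • x / x) := by
    rw [zpow_sub_one, div_mul_div_cancel, div_eq_mul_inv]
  rw [hsplit]
  exact Subgroup.mul_mem_sup hfixed (smul_div_self_mem_rootsOfUnity hx g)

theorem pow_mem_range_sup_rootsOfUnity [IsCyclotomicExtension Set.univ F E] {w : ℕ}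
    (hw : ∀ u ∈ CommGroup.torsion Fˣ, u ^ w = 1) {x : Eˣ} {n : ℕ} (hn : 0 < n)
    (hx : x ^ n ∈ (Units.map (algebraMap F E : F →* E)).range) :
    x ^ w ∈ (Units.map (algebraMap F E : F →* E)).range ⊔ rootsOfUnity n E := by
  have : NeZero n := ⟨hn.ne'⟩
  have : IsGalois F E := IsCyclotomicExtension.isGalois Set.univ F E
  have : IsMulCommutative Gal(E/F) := IsCyclotomicExtension.isMulCommutative Set.univ F E
  set P := (Units.map (algebraMap F E : F →* E)).range ⊔ rootsOfUnity n E
  set d := orderOf (x : Eˣ ⧸ P)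
  have hmem (k : ℤ) : x ^ k ∈ P ↔ (d : ℤ) ∣ k := by
    rw [orderOf_dvd_iff_zpow_eq_one, ← QuotientGroup.mk_zpow, QuotientGroup.eq_one_iff]
  have hdn : d ∣ n := by exact_mod_cast (hmem n).1 (by simpa using Subgroup.mem_sup_left hx)
  have hd : d ≠ 0 := ne_zero_of_dvd_ne_zero hn.ne' hdn
  -- If `g` acts on the `n`-th roots of unity as the `m`-th power, then `d ∣ m - 1`, so `g` fixes
  -- the `d`-th roots of unity. These therefore lie in `F`, which forces `d ∣ w`.
  obtain ⟨ξ, hξ⟩ := IsCyclotomicExtension.exists_isPrimitiveRoot F E (Set.mem_univ d) hd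
  lift ξ to Eˣ using hξ.isUnit hd
  rw [IsPrimitiveRoot.coe_units_iff] at hξ
  obtain ⟨u, rfl⟩ : ξ ∈ (Units.map (algebraMap F E : F →* E)).range := by
    rw [mem_range_unitsMap_algebraMap_iff_smul_eq]
    intro g
    obtain ⟨m, hm⟩ := rootsOfUnity.integer_power_of_ringEquiv' n (g : E ≃+* E)
    have hg (ζ : Eˣ) (hζ : ζ ∈ rootsOfUnity n E) : g • ζ = ζ ^ m := Units.ext (hm ζ hζ)
    have hdm : (d : ℤ) ∣ m - 1 := (hmem _).1 (zpow_sub_one_mem_of_smul_eq_zpow hx hg)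
    rw [hg ξ ((hξ.pow_eq_one_iff_dvd n).2 hdn), ← div_eq_one, div_eq_mul_inv, ← zpow_sub_one]
    exact (hξ.zpow_eq_one_iff_dvd _).2 hdm
  have hu : IsPrimitiveRoot u d := hξ.of_map_of_injective
    (Units.map_injective (algebraMap F E).injective)
  have hdw : d ∣ w := (hu.pow_eq_one_iff_dvd w).1
    (hw u (isOfFinOrder_iff_pow_eq_one.2 ⟨d, Nat.pos_of_ne_zero hd, hu.pow_eq_one⟩))
  simpa using (hmem w).2 (by exact_mod_cast hdw)

theorem exists_fg_radicalHull_le_torsion_sup [Algebra ℚ F] [Algebra.EssFiniteType ℚ F]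
    [IsCyclotomicExtension Set.univ F E] {A : Set Fˣ} (hA : A.Finite) :
    ∃ G : Subgroup Eˣ, G.FG ∧
      radicalHull (Units.map (algebraMap F E : F →* E) '' A) ≤ CommGroup.torsion Eˣ ⊔ G := by
  set incl := Units.map (algebraMap F E : F →* E)
  obtain ⟨w, hw0, hw⟩ := exists_pow_eq_one_of_mem_torsion F
  have hfg : ((radicalHull A).map incl).FG := by
    have := hA.to_subtype
    have hfgA := fg_radicalHull (Subtype.val : A → Fˣ)
    rw [Subtype.range_val] at hfgA
    exact fg_map_of_fg hfgA incl
  obtain ⟨G, hG, hmem⟩ := exists_fg_forall_mem_of_pow_mem hw0 hfg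
  refine ⟨G, hG, fun x hx => hmem x ?_⟩
  have ⟨n, hn, hxn⟩ := hx
  have hxrange : x ^ n ∈ incl.range := by
    rw [← MonoidHom.map_closure] at hxn
    exact Subgroup.map_le_range _ _ hxn
  have hsup := pow_mem_range_sup_rootsOfUnity hw hn hxrange
  rw [Subgroup.mem_sup] at hsup
  obtain ⟨_, ⟨y, rfl⟩, ζ, hζ, hyζ⟩ := hsup
  have hζtors : ζ ∈ CommGroup.torsion Eˣ :=
    isOfFinOrder_iff_pow_eq_one.2 ⟨n, hn, (mem_rootsOfUnity n ζ).1 hζ⟩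
  have hy : incl y ∈ radicalHull (incl '' A) := by
    rw [← mul_div_cancel_right (incl y) ζ, hyζ]
    exact div_mem (pow_mem hx w) (torsion_le_radicalHull _ hζtors)
  rw [← hyζ, mul_comm]
  exact Subgroup.mul_mem_sup hζtors ⟨y, (map_mem_radicalHull_image_iff
    (Units.map_injective (algebraMap F E).injective)).1 hy, rfl⟩

end Kummer

section NondegenerateSolutions

lemma sum_filter_character_eq_zero {G E ι : Type*} [Monoid G] [CommRing E] [IsDomain E]
    [Fintype ι] [DecidableEq (G →* E)] {χ : ι → G →* E} {y : ι → E} {c : E}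
    (h : ∀ g, ∑ i, y i * χ i g = c) {ψ : G →* E} (hψ : ψ ≠ 1) : ∑ i with χ i = ψ, y i = 0 := by
  have hvanish : ∑ i, y i • ⇑(χ i) - c • ⇑(1 : G →* E) = 0 := by
    funext g
    simp [Finset.sum_apply, h g]
  have hcoeff : Finsupp.linearCombination E (fun φ : G →* E => (φ : G → E))
      (∑ i, Finsupp.single (χ i) (y i) - Finsupp.single 1 c) = 0 := by
    simpa [map_sub, map_sum] using hvanish
  have hzero := DFunLike.congr_fun
    (linearIndependent_iff.1 (linearIndependent_monoidHom G E) _ hcoeff) ψ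
  simpa [Finsupp.single_apply, Finset.sum_filter, hψ.symm] using hzero

/-- The character `g ↦ g • x / x` attached to an element `x` whose ratios `g • x / x` are all
fixed by the group. -/
def ratioHom {G M : Type*} [Group G] [CommGroup M] [MulDistribMulAction G M] (x : M)
    (hx : ∀ g h : G, g • (h • x / x) = h • x / x) : G →* M where
  toFun g := g • x / x
  map_one' := by rw [one_smul, div_self']
  map_mul' g h := by
    rw [mul_comm, ← hx g h, smul_div', mul_smul, div_mul_div_cancel]

theorem mem_range_of_sum_eq_one {L E ι : Type*} [Field L] [Field E] [Algebra L E] [IsGalois L E]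
    [Fintype ι] (hroots : CommGroup.torsion Eˣ ≤ (Units.map (algebraMap L E : L →* E)).range)
    {l : ι → L} {x : ι → Eˣ}
    (hx : ∀ i, ∃ n : ℕ, 0 < n ∧ x i ^ n ∈ (Units.map (algebraMap L E : L →* E)).range)
    (hsum : ∑ i, algebraMap L E (l i) * x i = 1)
    (hsub : ∀ J : Finset ι, J.Nonempty → J ≠ Finset.univ → ∑ i ∈ J, algebraMap L E (l i) * x i ≠ 0)
    (i : ι) : x i ∈ (Units.map (algebraMap L E : L →* E)).range := by
  classical
  have hfixed (j : ι) (g h : Gal(E/L)) : g • (h • x j / x j) = h • x j / x j := by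
    obtain ⟨n, hn, hxn⟩ := hx j
    refine mem_range_unitsMap_algebraMap_iff_smul_eq.1 (hroots ?_) g
    exact isOfFinOrder_iff_pow_eq_one.2
      ⟨n, hn, (mem_rootsOfUnity n _).1 (smul_div_self_mem_rootsOfUnity hxn h)⟩
  let χ (j : ι) : Gal(E/L) →* E := (Units.coeHom E).comp (ratioHom (x j) (hfixed j))
  have hχsum (g : Gal(E/L)) : ∑ j, algebraMap L E (l j) * x j * χ j g = 1 := by
    have hχ (j : ι) : (x j : E) * χ j g = g (x j) :=
      congrArg Units.val (mul_div_cancel (x j) (g • x j))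
    calc ∑ j, algebraMap L E (l j) * x j * χ j g = g (∑ j, algebraMap L E (l j) * x j) := by
          simp only [mul_assoc, hχ, map_sum, map_mul, AlgEquiv.commutes]
      _ = 1 := by rw [hsum, map_one]
  rw [mem_range_unitsMap_algebraMap_iff_smul_eq]
  by_contra hmoved
  have hχi : χ i ≠ 1 := fun h1 => hmoved fun g =>
    div_eq_one.1 (Units.ext (DFunLike.congr_fun h1 g))
  have hzero := sum_filter_character_eq_zero hχsum hχi
  refine hsub _ ⟨i, by simp⟩ (fun huniv => ?_) hzero
  rw [huniv, hsum] at hzero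
  exact one_ne_zero hzero

theorem IsNondegenerateSolution.mem {F : Type*} [Field F] [Algebra F ℂ] {L : IntermediateField F ℂ}
    (hroots : ∀ ζ ∈ rootsOfUnityGroup, (ζ : ℂ) ∈ L) {k : ℕ} {l : Fin k → ℂ} (hl : ∀ i, l i ∈ L)
    {x : Fin k → ℂˣ} (hx : ∀ i, ∃ n : ℕ, 0 < n ∧ (x i : ℂ) ^ n ∈ L)
    (h : IsNondegenerateSolution l x) (i : Fin k) : (x i : ℂ) ∈ L := by
  let E := algebraicClosure L ℂ
  have : CharZero L := (RingHom.charZero_iff (algebraMap L ℂ).injective).2 inferInstance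
  have : IsGalois L E := ⟨⟩
  have hxE (i : Fin k) : (x i : ℂ) ∈ E := by
    obtain ⟨n, hn, hxn⟩ := hx i
    exact mem_algebraicClosure_iff'.2 (IsIntegral.of_pow hn
      (isIntegral_algebraMap (x := (⟨_, hxn⟩ : L))))
  have hval (u : Eˣ) : u ∈ (Units.map (algebraMap L E : L →* E)).range ↔ ((u : E) : ℂ) ∈ L := by
    rw [mem_range_unitsMap_iff]
    exact ⟨fun ⟨v, hv⟩ => hv ▸ v.2, fun hu => ⟨⟨_, hu⟩, rfl⟩⟩
  let x' (i : Fin k) : Eˣ :=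
    Units.mk0 ⟨x i, hxE i⟩ fun h0 => (x i).ne_zero (congrArg Subtype.val h0)
  have hcoe (J : Finset (Fin k)) : ((∑ i ∈ J, algebraMap L E ⟨l i, hl i⟩ * x' i : E) : ℂ) =
      ∑ i ∈ J, l i * (x i : ℂ) := by
    rw [AddSubmonoidClass.coe_finsetSum]
    rfl
  refine (hval (x' i)).1 (mem_range_of_sum_eq_one (l := fun i => ⟨l i, hl i⟩) (fun ζ hζ => ?_)
    (fun i => ?_) (Subtype.ext ?_) (fun J hJ hJuniv h0 => h.2 J hJ hJuniv ?_) i)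
  · exact (hval ζ).2 (hroots (Units.map (algebraMap E ℂ : E →* ℂ) ζ) (MonoidHom.isOfFinOrder _ hζ))
  · obtain ⟨n, hn, hxn⟩ := hx i
    exact ⟨n, hn, (hval _).2 hxn⟩
  · exact (hcoe _).trans h.1
  · rw [← hcoe, h0]
    rfl

lemma exists_pow_mem_of_mem_radicalHull {F E : Type*} [Field F] [Field E] [Algebra F E]
    {L : IntermediateField F E} {A : Set Eˣ} (hA : ∀ u ∈ A, (u : E) ∈ L) {x : Eˣ}
    (hx : x ∈ radicalHull A) : ∃ n : ℕ, 0 < n ∧ (x : E) ^ n ∈ L := by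
  obtain ⟨n, hn, hxn⟩ := hx
  have hle : Subgroup.closure A ≤ (Units.map (algebraMap L E : L →* E)).range :=
    (Subgroup.closure_le _).2 fun u hu => mem_range_unitsMap_iff.2 ⟨⟨u, hA u hu⟩, rfl⟩
  obtain ⟨y, hy⟩ := mem_range_unitsMap_iff.1 (hle hxn)
  exact ⟨n, hn, by rw [← Units.val_pow_eq_pow_val, ← hy]; exact y.2⟩

end NondegenerateSolutions

section Logarithms

/-- The exponential map as a group homomorphism. -/
noncomputable def expUnitHom : Multiplicative ℂ →* ℂˣ where
  toFun z := expUnit z.toAdd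
  map_one' := Units.ext Complex.exp_zero
  map_mul' z w := Units.ext (Complex.exp_add z.toAdd w.toAdd)

/-- The group `exp V` of exponentials of the elements of a rational subspace `V`. -/
noncomputable def expSubgroup (V : Submodule ℚ ℂ) : Subgroup ℂˣ :=
  V.toAddSubgroup.toSubgroup.map expUnitHom

lemma expUnit_mem_expSubgroup {V : Submodule ℚ ℂ} {v : ℂ} (hv : v ∈ V) :
    expUnit v ∈ expSubgroup V :=
  ⟨Multiplicative.ofAdd v, hv, rfl⟩

lemma expUnit_zero : expUnit 0 = 1 :=
  map_one expUnitHom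

lemma expUnit_add (z w : ℂ) : expUnit (z + w) = expUnit z * expUnit w :=
  map_mul expUnitHom (.ofAdd z) (.ofAdd w)

lemma expUnit_nsmul (n : ℕ) (z : ℂ) : expUnit (n • z) = expUnit z ^ n :=
  map_pow expUnitHom (.ofAdd z) n

lemma expUnit_zsmul (n : ℤ) (z : ℂ) : expUnit (n • z) = expUnit z ^ n :=
  map_zpow expUnitHom (.ofAdd z) n

lemma expUnit_rat_smul_mem_rootsOfUnityGroup (q : ℚ) :
    expUnit (q • (Complex.I * Real.pi)) ∈ rootsOfUnityGroup := by
  refine isOfFinOrder_iff_pow_eq_one.2 ⟨2 * q.den, by positivity, ?_⟩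
  rw [← expUnit_nsmul]
  refine Units.ext (Complex.exp_eq_one_iff.2 ⟨q.num, ?_⟩)
  have hq : (q : ℂ) * q.den = q.num := by exact_mod_cast q.mul_den_eq_num
  rw [Rat.smul_def, nsmul_eq_mul]
  push_cast
  linear_combination (2 * Real.pi * Complex.I) * hq

lemma radicalHull_le_rootsOfUnityGroup_sup_expSubgroup {V : Submodule ℚ ℂ} {A : Set ℂˣ}
    (hA : A ⊆ (rootsOfUnityGroup ⊔ expSubgroup V : Subgroup ℂˣ)) :
    radicalHull A ≤ rootsOfUnityGroup ⊔ expSubgroup V := by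
  rintro x ⟨n, hn, hxn⟩
  obtain ⟨ζ, hζ, _, ⟨v, hv, rfl⟩, hζv⟩ :=
    Subgroup.mem_sup.1 ((Subgroup.closure_le _).2 hA hxn)
  set y := expUnit ((n : ℚ)⁻¹ • v.toAdd)
  have hyn : y ^ n = expUnitHom v := by
    rw [← expUnit_nsmul, ← Nat.cast_smul_eq_nsmul ℚ, smul_inv_smul₀ (by exact_mod_cast hn.ne')]
    rfl
  have hxy : x / y ∈ rootsOfUnityGroup := by
    refine (isOfFinOrder_pow.1 ?_).resolve_right hn.ne'
    rwa [div_pow, hyn, ← hζv, mul_div_cancel_right]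
  rw [← div_mul_cancel x y]
  exact Subgroup.mul_mem_sup hxy (expUnit_mem_expSubgroup (V.smul_mem _ hv))

lemma exists_le_notMem_le_span_singleton_sup {k E : Type*} [DivisionRing k] [AddCommGroup E]
    [Module k E] {e : E} (he : e ≠ 0) (W : Submodule k E) :
    ∃ V ≤ W, e ∉ V ∧ W ≤ Submodule.span k {e} ⊔ V := by
  obtain ⟨V, hdisj, hV⟩ := IsModularLattice.exists_disjoint_and_sup_eq
    (inf_le_left : W ⊓ Submodule.span k {e} ≤ W)
  have hVW : V ≤ W := hV ▸ le_sup_right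
  refine ⟨V, hVW, fun heV => he ?_, hV.ge.trans (sup_le_sup_right inf_le_right _)⟩
  exact Submodule.disjoint_def.1 hdisj e ⟨hVW heV, Submodule.mem_span_singleton_self e⟩ heV

lemma exists_le_radicalHull_le_rootsOfUnityGroup_sup_expSubgroup (W : Submodule ℚ ℂ) :
    ∃ V ≤ W, Complex.I * (Real.pi : ℂ) ∉ V ∧
      ∀ A ⊆ expUnit '' W, radicalHull A ≤ rootsOfUnityGroup ⊔ expSubgroup V := by
  have hiPi : Complex.I * (Real.pi : ℂ) ≠ 0 := by simp [Real.pi_ne_zero]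
  obtain ⟨V, hVW, hV, hle⟩ := exists_le_notMem_le_span_singleton_sup hiPi W
  refine ⟨V, hVW, hV, fun A hA => radicalHull_le_rootsOfUnityGroup_sup_expSubgroup fun x hx => ?_⟩
  obtain ⟨w, hw, rfl⟩ := hA hx
  obtain ⟨_, hq, v, hv, rfl⟩ := Submodule.mem_sup.1 (hle hw)
  obtain ⟨q, rfl⟩ := Submodule.mem_span_singleton.1 hq
  rw [SetLike.mem_coe, expUnit_add]
  exact Subgroup.mul_mem_sup (expUnit_rat_smul_mem_rootsOfUnityGroup q)
    (expUnit_mem_expSubgroup hv)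

lemma exists_linearIndependent_span_int_eq {E : Type*} [AddCommGroup E] [Module ℚ E] {S : Set E}
    (hS : S.Finite) : ∃ (t : ℕ) (c : Fin t → E), LinearIndependent ℚ c ∧
      Submodule.span ℤ (Set.range c) = Submodule.span ℤ S := by
  have : Module.IsTorsionFree ℤ E := .trans ℚ
  have : Module.Finite ℤ (Submodule.span ℤ S) := Module.Finite.span_of_finite ℤ hS
  let b := Module.finBasis ℤ (Submodule.span ℤ S)
  refine ⟨_, fun j => (b j : E), ?_, ?_⟩
  · rw [← LinearIndependent.iff_fractionRing ℤ ℚ]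
    exact b.linearIndependent.map' (Submodule.subtype _) (Submodule.ker_subtype _)
  · change Submodule.span ℤ (Set.range (Submodule.subtype _ ∘ b)) = _
    rw [Set.range_comp, Submodule.span_image, b.span_eq, Submodule.map_top, Submodule.range_subtype]

lemma expUnit_mem_closure_range {ι : Type*} {c : ι → ℂ} {z : ℂ}
    (hz : z ∈ Submodule.span ℤ (Set.range c)) :
    expUnit z ∈ Subgroup.closure (Set.range fun j => expUnit (c j)) := by
  induction hz using Submodule.span_induction with
  | mem _ hz =>
    obtain ⟨j, rfl⟩ := hz
    exact Subgroup.subset_closure (Set.mem_range_self j)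
  | zero => exact expUnit_zero ▸ one_mem _
  | add z w _ _ hz hw => exact expUnit_add z w ▸ mul_mem hz hw
  | smul n z _ hz => exact expUnit_zsmul n z ▸ zpow_mem hz n

theorem exists_linearIndependentOverIPi_le_sup_closure {V : Submodule ℚ ℂ}
    (hV : Complex.I * (Real.pi : ℂ) ∉ V) {G : Subgroup ℂˣ} (hG : G.FG)
    (hGV : G ≤ rootsOfUnityGroup ⊔ expSubgroup V) :
    ∃ (t : ℕ) (c : Fin t → ℂ), (∀ j, c j ∈ V) ∧ LinearIndependentOverIPi c ∧
      G ≤ rootsOfUnityGroup ⊔ Subgroup.closure (Set.range fun j => expUnit (c j)) := by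
  obtain ⟨S, rfl⟩ := hG
  have hlog (s : S) : ∃ ζ ∈ rootsOfUnityGroup, ∃ v ∈ V, ζ * expUnit v = s := by
    obtain ⟨ζ, hζ, _, ⟨v, hv, rfl⟩, hζv⟩ := Subgroup.mem_sup.1 (hGV (Subgroup.subset_closure s.2))
    exact ⟨ζ, hζ, v.toAdd, hv, hζv⟩
  choose ζ hζ v hv hζv using hlog
  obtain ⟨t, c, hc, hspan⟩ := exists_linearIndependent_span_int_eq (Set.finite_range v)
  have hcV (j : Fin t) : c j ∈ V := by
    have hle : Submodule.span ℤ (Set.range v) ≤ V.restrictScalars ℤ :=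
      Submodule.span_le.2 (Set.range_subset_iff.2 hv)
    exact hle (hspan ▸ Submodule.subset_span (Set.mem_range_self j))
  refine ⟨t, c, hcV, linearIndependent_finCons.2 ⟨hc, fun hmem => hV ?_⟩, ?_⟩
  · exact Submodule.span_le.2 (Set.range_subset_iff.2 hcV) hmem
  rw [Subgroup.closure_le]
  intro s hs
  have hvs : v ⟨s, hs⟩ ∈ Submodule.span ℤ (Set.range c) :=
    hspan ▸ Submodule.subset_span (Set.mem_range_self _)
  have hexp := expUnit_mem_closure_range hvs
  have hs' : ζ ⟨s, hs⟩ * expUnit (v ⟨s, hs⟩) = s := hζv _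
  rw [SetLike.mem_coe, ← hs']
  exact Subgroup.mul_mem_sup (hζ _) hexp

end Logarithms

section ExtensionsOfTheCyclotomicClosure

lemma coe_mem_cyclotomicClosure {ζ : ℂˣ} (hζ : ζ ∈ rootsOfUnityGroup) :
    (ζ : ℂ) ∈ cyclotomicClosure :=
  IntermediateField.subset_adjoin _ _ (Set.mem_image_of_mem _ hζ)

lemma exists_fg_le_adjoin_roots {L : IntermediateField cyclotomicClosure ℂ} (hL : L.FG)
    {A : Set ℂ} (hA : A.Finite) :
    ∃ F : IntermediateField ℚ ℂ, F.FG ∧ A ⊆ F ∧ ∀ z ∈ L,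
      z ∈ IntermediateField.adjoin F {b : ℂ | ∃ n ∈ Set.univ, n ≠ 0 ∧ b ^ n = 1} := by
  obtain ⟨S, rfl⟩ := hL
  refine ⟨IntermediateField.adjoin ℚ (S ∪ A),
    IntermediateField.fg_adjoin_of_finite (S.finite_toSet.union hA),
    Set.subset_union_right.trans (IntermediateField.subset_adjoin _ _), fun z hz => ?_⟩
  set F := IntermediateField.adjoin ℚ (S ∪ A : Set ℂ)
  set E := IntermediateField.adjoin F {b : ℂ | ∃ n ∈ Set.univ, n ≠ 0 ∧ b ^ n = 1}
  have hcyc : cyclotomicClosure ≤ E.restrictScalars ℚ := by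
    refine IntermediateField.adjoin_le_iff.2 ?_
    rintro _ ⟨u, hu, rfl⟩
    obtain ⟨n, hn, hun⟩ := isOfFinOrder_iff_pow_eq_one.1 hu
    exact IntermediateField.subset_adjoin F _ ⟨n, Set.mem_univ n, hn.ne', congrArg Units.val hun⟩
  induction hz using IntermediateField.adjoin_induction with
  | mem z hz =>
    exact E.algebraMap_mem ⟨z, IntermediateField.subset_adjoin ℚ _ (Set.mem_union_left _ hz)⟩
  | algebraMap q => exact hcyc q.2
  | add x y _ _ hx hy => exact add_mem hx hy
  | inv x _ hx => exact inv_mem hx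
  | mul x y _ _ hx hy => exact mul_mem hx hy

theorem exists_fg_forall_mem_radicalHull {L : IntermediateField cyclotomicClosure ℂ} (hL : L.FG)
    {A : Set ℂˣ} (hA : A.Finite) :
    ∃ G : Subgroup ℂˣ, G.FG ∧
      ∀ x ∈ radicalHull A, (x : ℂ) ∈ L → x ∈ rootsOfUnityGroup ⊔ G := by
  obtain ⟨F, hF, hAF, hLF⟩ := exists_fg_le_adjoin_roots hL (hA.image Units.val)
  have : Algebra.EssFiniteType ℚ F := IntermediateField.essFiniteType_iff.2 hF
  let E := IntermediateField.adjoin F {b : ℂ | ∃ n ∈ Set.univ, n ≠ 0 ∧ b ^ n = 1}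
  have : IsCyclotomicExtension Set.univ F E :=
    IntermediateField.isCyclotomicExtension_adjoin_of_exists_isPrimitiveRoot _ _ _
      fun n _ hn => ⟨_, Complex.isPrimitiveRoot_exp n hn⟩
  let f : Fˣ →* Eˣ := Units.map (algebraMap F E : F →* E)
  let g : Eˣ →* ℂˣ := Units.map (algebraMap E ℂ : E →* ℂ)
  have hg : Function.Injective g := Units.map_injective (algebraMap E ℂ).injective
  have hf : Function.Injective f := Units.map_injective (algebraMap F E).injective
  have hrange : g '' (f '' (g ∘ f ⁻¹' A)) = A := by
    rw [← Set.image_comp]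
    refine Set.image_preimage_eq_of_subset fun a ha => ?_
    exact ⟨Units.mk0 (⟨a, hAF (Set.mem_image_of_mem _ ha)⟩ : F)
      fun h => a.ne_zero (congrArg Subtype.val h), Units.ext rfl⟩
  obtain ⟨G, hG, hGA⟩ := exists_fg_radicalHull_le_torsion_sup (E := E)
    (hA.preimage (hg.comp hf).injOn)
  refine ⟨G.map g, fg_map_of_fg hG g, fun x hx hxL => ?_⟩
  obtain ⟨y, rfl⟩ : x ∈ g.range := mem_range_unitsMap_iff.2 ⟨⟨x, hLF x hxL⟩, rfl⟩
  rw [← hrange, map_mem_radicalHull_image_iff hg] at hx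
  have hy := Subgroup.mem_map_of_mem g (hGA hx)
  rw [Subgroup.map_sup] at hy
  exact sup_le_sup_right (CommGroup.map_torsion_le g) _ hy

end ExtensionsOfTheCyclotomicClosure

lemma mem_of_mem_span_rat_range {K : Subfield ℂ} {ι : Type*} {a : ι → ℂ} (ha : ∀ i, a i ∈ K)
    {z : ℂ} (hz : z ∈ Submodule.span ℚ (Set.range a)) : z ∈ K := by
  induction hz using Submodule.span_induction with
  | mem _ hz =>
    obtain ⟨i, rfl⟩ := hz
    exact ha i
  | zero => exact K.zero_mem
  | add _ _ _ _ hz hw => exact K.add_mem hz hw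
  | smul q z _ hz => exact Rat.smul_def q z ▸ K.mul_mem (SubfieldClass.ratCast_mem K q) hz

theorem mainTheorem4_general {ι : Type*} [Finite ι] (a : ι → ℂ)
    (L : IntermediateField cyclotomicClosure ℂ) (hLfg : L.FG) :
    ∃ (t : ℕ) (c : Fin t → ℂ), (∀ j, c j ∈ Submodule.span ℚ (Set.range a)) ∧
      LinearIndependentOverIPi c ∧
      ∀ (k : ℕ) (l : Fin k → ℂ), (∀ i, l i ∈ L) →
        ∀ x : Fin k → ℂˣ,
          (∀ i, x i ∈ radicalHull (Set.range fun j => expUnit (a j))) →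
          IsNondegenerateSolution l x →
          ∀ i, x i ∈ rootsOfUnityGroup ⊔ Subgroup.closure (Set.range fun j => expUnit (c j)) := by
  set A : Set ℂˣ := Set.range fun j => expUnit (a j)
  have hA : A.Finite := Set.finite_range _
  let L' := L ⊔ IntermediateField.adjoin cyclotomicClosure (Units.val '' A)
  have hL'fg : L'.FG := IntermediateField.fg_sup hLfg
    (IntermediateField.fg_adjoin_of_finite (hA.image Units.val))
  have hLL' : L ≤ L' := le_sup_left
  have hAL' : Units.val '' A ⊆ L' := IntermediateField.adjoin_le_iff.1 le_sup_right
  have hroots (ζ) (hζ : ζ ∈ rootsOfUnityGroup) : (ζ : ℂ) ∈ L' :=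
    L'.algebraMap_mem ⟨ζ, coe_mem_cyclotomicClosure hζ⟩
  obtain ⟨G, hG, hmem⟩ := exists_fg_forall_mem_radicalHull hL'fg hA
  obtain ⟨V, hVa, hV, hle⟩ :=
    exists_le_radicalHull_le_rootsOfUnityGroup_sup_expSubgroup (Submodule.span ℚ (Set.range a))
  have hAV : radicalHull A ≤ rootsOfUnityGroup ⊔ expSubgroup V := hle A <| by
    rintro _ ⟨i, rfl⟩
    exact Set.mem_image_of_mem _ (Submodule.subset_span (Set.mem_range_self i))
  obtain ⟨t, c, hc, hcind, hGc⟩ := exists_linearIndependentOverIPi_le_sup_closure hV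
    (fg_of_le_of_fg inf_le_left hG) ((inf_le_right : G ⊓ radicalHull A ≤ _).trans hAV)
  refine ⟨t, c, fun j => hVa (hc j), hcind, fun k l hl x hx h i => ?_⟩
  have hxL' : (x i : ℂ) ∈ L' := h.mem hroots (fun i => hLL' (hl i))
    (fun i => exists_pow_mem_of_mem_radicalHull (Set.forall_mem_image.1 hAL') (hx i)) i
  have hxG : x i ∈ rootsOfUnityGroup ⊔ G ⊓ radicalHull A :=
    sup_inf_assoc_of_le G (torsion_le_radicalHull A) ▸ ⟨hmem _ (hx i) hxL', hx i⟩
  exact sup_le le_sup_left hGc hxG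

theorem mainTheorem4
    (K : Subfield ℂ) (hKclosed : IsAlgClosed K)
    (hKtrdeg : Algebra.trdeg ℚ K < Cardinal.aleph0)
    (hKpi : (Real.pi : ℂ) ∈ K)
    {s : ℕ} (a : Fin s → ℂ) (haK : ∀ i, a i ∈ K) (ha : LinearIndependentOverIPi a)
    (L : IntermediateField cyclotomicClosure ℂ) (hLfg : L.FG)
    (hLa : ∀ i, Complex.exp (a i) ∈ L) :
    ∃ (t : ℕ) (c : Fin t → ℂ), (∀ j, c j ∈ K) ∧ LinearIndependentOverIPi c ∧
      ∀ (k : ℕ) (l : Fin k → ℂ), (∀ i, l i ∈ L) →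
        ∀ x : Fin k → ℂˣ,
          (∀ i, x i ∈ radicalHull (Set.range fun j => expUnit (a j))) →
          IsNondegenerateSolution l x →
          ∀ i, x i ∈ rootsOfUnityGroup ⊔ Subgroup.closure (Set.range fun j => expUnit (c j)) := by
  obtain ⟨t, c, hc, h⟩ := mainTheorem4_general a L hLfg
  exact ⟨t, c, fun j => mem_of_mem_span_rat_range haK (hc j), h⟩
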